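/- A nondeterministic finite automaton $M=\langle Q,\Sigma,\delta,q_0,F\rangle$ has a finite set of states $Q$, a finite input alphabet $\Sigma$, a single initial state $q_0\in Q$, accepting states $F\subseteq Q$, and a transition function $\delta\colon Q\times\Sigma\to 2^Q$. A path for a word $a_1\cdots a_k\in\Sigma^*$ is a sequence of states $q_0,q_1,\dots,q_k$ that starts in the initial state and satisfies $q_{i+1}\in\delta(q_i,a_{i+1})$ for $0\le i<k$; it is accepting if $q_k\in F$. As an NFA, $M$ accepts the words for which there is at least one accepting path; as an exclusive NFA (XNFA), $M$ accepts the words for which there is exactly one accepting path. $M$ is unary if $|\Sigma|=1$. **Proposition.** Let $n\ge 2$ and let $M$ be a unary $n$-state XNFA. Then $e^{\Theta(\sqrt{n\cdot\ln n})}$ states are sufficient for an NFA to accept the language accepted by $M$. That is, there is a function $h\colon\mathbb N\to\mathbb R$ with $h(n)\in\Theta(\sqrt{n\cdot\ln n})$ such that, for every $n\ge 2$, the language accepted by any unary $n$-state XNFA is accepted by some NFA over the same alphabet with at most $e^{h(n)}$ states. -/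

import Mathlib

/-- A nondeterministic finite automaton `⟨Q, Σ, δ, q₀, F⟩` with state set `σ`, input alphabet `α` and
a single initial state. The same device is read as an NFA or as an XNFA, depending on which
acceptance condition is used (`nfaLanguage` or `xnfaLanguage` below). Finiteness of `σ` and `α`
is imposed where the automaton is used. -/
structure NFAutomaton (α : Type*) (σ : Type*) where
  /-- the transition function `δ : Q × Σ → 2^Q` -/
  step : σ → α → Set σ
  /-- the initial state -/
  start : σ
  /-- the set of accepting states -/
  accept : Set σ

namespace NFAutomaton

variable {α σ : Type*}

/-- `p = (p₀, …, p_m)` is a (complete) path of `M` for the word `w = a₁ ⋯ a_m`: it starts in the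
initial state, and `p_{i+1} ∈ δ(p_i, a_{i+1})` for `0 ≤ i < m`. -/
def IsPath (M : NFAutomaton α σ) (w : List α) (p : Fin (w.length + 1) → σ) : Prop :=
  p 0 = M.start ∧ ∀ i : Fin w.length, p i.succ ∈ M.step (p i.castSucc) (w.get i)

/-- An accepting path for `w` is a complete path for `w` that ends in an accepting state. -/
def IsAcceptingPath (M : NFAutomaton α σ) (w : List α) (p : Fin (w.length + 1) → σ) : Prop :=
  M.IsPath w p ∧ p (Fin.last w.length) ∈ M.accept

/-- The language accepted by `M` as an NFA: at least one path on the input is accepting. -/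
def nfaLanguage (M : NFAutomaton α σ) : Language α :=
  {w | ∃ p, M.IsAcceptingPath w p}

/-- The language accepted by `M` as an XNFA: exactly one path on the input is accepting. -/
def xnfaLanguage (M : NFAutomaton α σ) : Language α :=
  {w | ∃! p, M.IsAcceptingPath w p}

end NFAutomaton

/-!
Over a one-letter alphabet a path is a walk of prescribed length in the transition graph, and the
language of an XNFA is determined by the lengths for which there is at least one accepting walk but
there are not two distinct ones. Two distinct walks of equal length form a single walk in the graph
`splitRel` on `σ ⊕ σ × σ`, so that both conditions ask for which lengths a graph has a walk between
given states.

Such sets of lengths are ultimately periodic. Choose a shortest cycle through one state of each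
strongly connected component, of length `g`. Every state of the component that lies on a closed walk
has closed walks of all large lengths divisible by `g` (`hasWalk_of_sccPeriod_dvd`), and in `splitRel`
the pair of two such states has closed walks of all large lengths divisible by the least common
multiple of their cycle lengths (`splitRel_pump`). Cutting out parts of a walk without changing its
length modulo `g`, and making up the difference with closed walks, shows that beyond a polynomial
bound only the length modulo a common multiple `P` of all the `g` matters (`HasWalk.of_modEq`). The
same `P` serves for pairs of walks, so a cycle of length `P` with a polynomial tail accepts the
language.

The chosen cycles lie in disjoint components, so their lengths sum to at most `n`, and they have a
common multiple `e^{O(√(n ln n))}` by Chebyshev's bound `ψ(x) = O(x)`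
(`exists_common_multiple_log_le`).
-/

/-! ### Walks of prescribed length -/

/-- There is a walk `u = f 0, f 1, …, f k = v` of length `k` along the relation `R`. The values of
`f` beyond `k` are irrelevant. -/
def HasWalk {S : Type*} (R : S → S → Prop) (k : ℕ) (u v : S) : Prop :=
  ∃ f : ℕ → S, f 0 = u ∧ f k = v ∧ ∀ i < k, R (f i) (f (i + 1))

namespace HasWalk

variable {S T : Type*} {R : S → S → Prop} {u v w : S} {k l : ℕ}

theorem refl (R : S → S → Prop) (u : S) : HasWalk R 0 u u :=
  ⟨fun _ => u, rfl, rfl, by simp⟩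

theorem trans (h₁ : HasWalk R k u v) (h₂ : HasWalk R l v w) : HasWalk R (k + l) u w := by
  obtain ⟨f, f0, fk, hf⟩ := h₁
  obtain ⟨g, g0, gl, hg⟩ := h₂
  refine ⟨fun i => if i ≤ k then f i else g (i - k), by simpa using f0, ?_, fun i hi => ?_⟩
  · rcases Nat.eq_zero_or_pos l with rfl | hl
    · simpa [fk, ← g0] using gl
    · simpa [show ¬ k + l ≤ k by omega] using gl
  · rcases lt_trichotomy i k with h | rfl | h
    · simpa [h.le, Nat.succ_le_of_lt h] using hf i h
    · simpa [fk, g0] using hg 0 (by omega)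
    · have := hg (i - k) (by omega)
      rw [show i - k + 1 = i + 1 - k by omega] at this
      simpa [show ¬ i ≤ k by omega, show ¬ i + 1 ≤ k by omega] using this

theorem mul (h : HasWalk R k u u) (m : ℕ) : HasWalk R (m * k) u u := by
  induction m with
  | zero => simpa using refl R u
  | succ m ih => simpa [Nat.succ_mul] using ih.trans h

theorem map {R' : T → T → Prop} (φ : S → T) (hφ : ∀ a b, R a b → R' (φ a) (φ b))
    (h : HasWalk R k u v) : HasWalk R' k (φ u) (φ v) := by
  obtain ⟨f, f0, fk, hf⟩ := h
  exact ⟨φ ∘ f, by simp [f0], by simp [fk], fun i hi => hφ _ _ (hf i hi)⟩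

/-- The part between positions `i` and `j` of a sequence that follows `R` up to `k`. -/
theorem segment {f : ℕ → S} (hf : ∀ i < k, R (f i) (f (i + 1))) {i j : ℕ} (hij : i ≤ j)
    (hj : j ≤ k) : HasWalk R (j - i) (f i) (f j) :=
  ⟨fun t => f (i + t), rfl, by simp [Nat.add_sub_cancel' hij], fun t ht => hf _ (by omega)⟩

/-- A walk can be shortened to length below `|S| · g` without changing its length modulo `g`: a
longer walk visits some state at two times that are congruent modulo `g`, and the part in between
can be cut out. -/
theorem exists_modEq_lt [Fintype S] {g : ℕ} (hg : 0 < g) (h : HasWalk R k u v) :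
    ∃ k' < Fintype.card S * g, k' ≡ k [MOD g] ∧ HasWalk R k' u v := by
  induction k using Nat.strong_induction_on with
  | _ k ih =>
  by_cases hk : k < Fintype.card S * g
  · exact ⟨k, hk, rfl, h⟩
  obtain ⟨f, rfl, rfl, hf⟩ := h
  have : NeZero g := ⟨hg.ne'⟩
  obtain ⟨a, b, hab, he⟩ := Fintype.exists_ne_map_eq_of_card_lt
    (fun i : Fin (k + 1) => (f i, Fin.ofNat g i)) (by simp; omega)
  wlog hlt : a < b generalizing a b
  · exact this b a hab.symm he.symm (lt_of_le_of_ne (not_lt.mp hlt) hab.symm)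
  simp only [Prod.mk.injEq, Fin.ofNat, Fin.mk.injEq] at he
  have hb := b.is_le
  have hlt' : (a : ℕ) < b := hlt
  have h₁ := (segment hf (Nat.zero_le a) (by omega)).trans
    (he.1 ▸ segment hf (i := b) (j := k) (by omega) le_rfl)
  obtain ⟨k', hk', hmod, hw⟩ := ih _ (by omega) h₁
  refine ⟨k', hk', hmod.trans ?_, hw⟩
  have : (a : ℕ) + (k - b) ≡ b + (k - b) [MOD g] := Nat.ModEq.add_right _ he.2
  rwa [Nat.add_sub_cancel' hb] at this

/-- Suppose every state `s` on a closed walk has closed walks of all lengths `m ≥ B` divisible by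
some `g ≤ G` with `g ∣ P`. Then the lengths of the walks from `u` to `v` depend, beyond an explicit
bound, only on their residue modulo `P`: a long walk meets a closed walk at some state `s`, the
parts before and after `s` can be shortened modulo `g`, and the missing length is made up at `s`. -/
theorem of_modEq [Fintype S] {B G P : ℕ}
    (hpump : ∀ s, (∃ c, 0 < c ∧ HasWalk R c s s) →
      ∃ g, 0 < g ∧ g ≤ G ∧ g ∣ P ∧ ∀ m, B ≤ m → g ∣ m → HasWalk R m s s)
    (hk : Fintype.card S ≤ k) (hl : 2 * (Fintype.card S * G) + B ≤ l) (hkl : k ≡ l [MOD P])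
    (h : HasWalk R k u v) : HasWalk R l u v := by
  obtain ⟨f, rfl, rfl, hf⟩ := h
  obtain ⟨a, b, hab, he⟩ := Fintype.exists_ne_map_eq_of_card_lt
    (fun i : Fin (k + 1) => f i) (by simp; omega)
  wlog hlt : a < b generalizing a b
  · exact this b a hab.symm he.symm (lt_of_le_of_ne (not_lt.mp hlt) hab.symm)
  have hb := b.is_le
  have hlt' : (a : ℕ) < b := hlt
  obtain ⟨g, hg0, hgG, hgP, hg⟩ := hpump (f a) ⟨b - a, by omega, by
    simpa only [← he] using segment hf hlt'.le hb⟩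
  obtain ⟨c, hc, hca, hw⟩ := exists_modEq_lt hg0 (segment hf (Nat.zero_le a) (by omega))
  obtain ⟨d, hd, hdk, hw'⟩ := exists_modEq_lt hg0
    (segment hf (i := a) (j := k) (by omega) le_rfl)
  have hG : Fintype.card S * g ≤ Fintype.card S * G := Nat.mul_le_mul_left _ hgG
  have hmod : c + d ≡ l [MOD g] := by
    refine (hca.add hdk).trans ?_
    rw [Nat.sub_zero, Nat.add_sub_cancel' (by omega)]
    exact hkl.of_dvd hgP
  have := (hw.trans (hg (l - (c + d)) (by omega)
    ((Nat.modEq_iff_dvd' (by omega)).mp hmod))).trans hw'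
  rwa [show c + (l - (c + d)) + d = l by omega] at this

end HasWalk

/-! ### One cycle length for each strongly connected component -/

/-- Mutual reachability along `R`; its classes are the strongly connected components. -/
def sccSetoid {S : Type*} (R : S → S → Prop) : Setoid S where
  r x y := (∃ k, HasWalk R k x y) ∧ ∃ k, HasWalk R k y x
  iseqv :=
    { refl := fun x => ⟨⟨0, .refl R x⟩, 0, .refl R x⟩
      symm := fun h => ⟨h.2, h.1⟩
      trans := fun ⟨⟨_, a⟩, _, b⟩ ⟨⟨_, c⟩, _, d⟩ => ⟨⟨_, a.trans c⟩, _, d.trans b⟩ }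

/-- The length of a shortest nonempty closed walk at `x`, and `0` if there is none. -/
noncomputable def returnLength {S : Type*} (R : S → S → Prop) (x : S) : ℕ :=
  sInf {k | 0 < k ∧ HasWalk R k x x}

section

variable {S : Type*} {R : S → S → Prop} {x : S}

theorem returnLength_spec (h : ∃ k, 0 < k ∧ HasWalk R k x x) :
    0 < returnLength R x ∧ HasWalk R (returnLength R x) x x :=
  Nat.sInf_mem (s := {k | 0 < k ∧ HasWalk R k x x}) h

/-- A shortest closed walk is a simple cycle, and it stays in the component of its base point. -/
theorem returnLength_le_card [Fintype S] (x : S) [DecidablePred fun y => sccSetoid R y x] :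
    returnLength R x ≤ (Finset.univ.filter fun y => sccSetoid R y x).card := by
  by_cases h : ∃ k, 0 < k ∧ HasWalk R k x x
  swap
  · have : {k | 0 < k ∧ HasWalk R k x x} = ∅ :=
      Set.eq_empty_iff_forall_notMem.mpr fun k hk => h ⟨k, hk⟩
    simp [returnLength, this]
  obtain ⟨h0, f, f0, fk, hf⟩ := returnLength_spec h
  set c := returnLength R x
  have hinj : ∀ i j, i < j → j < c → f i ≠ f j := by
    intro i j hij hj he
    have hw := (HasWalk.segment hf (Nat.zero_le i) (by omega)).trans
      (he ▸ HasWalk.segment hf (i := j) (j := c) hj.le le_rfl)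
    rw [f0, fk] at hw
    have : c ≤ i - 0 + (c - j) :=
      Nat.sInf_le (s := {k | 0 < k ∧ HasWalk R k x x}) ⟨by omega, hw⟩
    omega
  conv_lhs => rw [← Finset.card_range c]
  refine Finset.card_le_card_of_injOn f (fun i hi => ?_) (fun i hi j hj he => ?_)
  · have hi' : i < c := by simpa using hi
    have h₁ := HasWalk.segment hf (Nat.zero_le i) hi'.le
    have h₂ := HasWalk.segment hf (i := i) (j := c) hi'.le le_rfl
    rw [f0] at h₁
    rw [fk] at h₂
    exact Finset.mem_coe.mpr (Finset.mem_filter.mpr ⟨Finset.mem_univ _, ⟨_, h₂⟩, _, h₁⟩)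
  · simp only [Finset.coe_range, Set.mem_Iio] at hi hj
    rcases lt_trichotomy i j with h | h | h
    · exact (hinj i j h hj he).elim
    · exact h
    · exact (hinj j i h hi he.symm).elim

theorem sum_returnLength_le_card [Fintype S] [Fintype (Quotient (sccSetoid R))] :
    ∑ q : Quotient (sccSetoid R), returnLength R q.out ≤ Fintype.card S := by
  classical
  rw [← Finset.card_univ, Finset.card_eq_sum_card_fiberwise
    (f := fun y => (⟦y⟧ : Quotient (sccSetoid R))) (t := Finset.univ) (by simp)]
  refine Finset.sum_le_sum fun q _ => (returnLength_le_card q.out).trans (le_of_eq ?_)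
  congr 1
  ext y
  simp only [Finset.mem_filter, Finset.mem_univ, true_and]
  conv_rhs => rw [← q.out_eq]
  exact Quotient.eq.symm

/-- The cycle length attached to the component of `x`. It depends on the component only, so that
the lengths attached to all components sum to at most `|S|`. -/
noncomputable def sccPeriod (R : S → S → Prop) (x : S) : ℕ :=
  returnLength R (⟦x⟧ : Quotient (sccSetoid R)).out

theorem sccPeriod_le_card [Fintype S] (x : S) : sccPeriod R x ≤ Fintype.card S := by
  classical
  exact (returnLength_le_card _).trans (Finset.card_le_univ _)

/-- Going `g = sccPeriod R x` times from `x` to the chosen cycle and back costs a multiple of `g`,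
and the cycle itself supplies all further multiples of `g`. -/
theorem hasWalk_of_sccPeriod_dvd [Fintype S] (h : ∃ k, 0 < k ∧ HasWalk R k x x) :
    0 < sccPeriod R x ∧ ∀ m, 2 * Fintype.card S ^ 2 ≤ m → sccPeriod R x ∣ m → HasWalk R m x x := by
  obtain ⟨⟨a₀, ha₀⟩, b₀, hb₀⟩ : sccSetoid R x (⟦x⟧ : Quotient (sccSetoid R)).out :=
    (sccSetoid R).symm (Quotient.mk_out (s := sccSetoid R) x)
  have hle := sccPeriod_le_card (R := R) x
  rw [sccPeriod] at hle ⊢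
  set y := (⟦x⟧ : Quotient (sccSetoid R)).out
  obtain ⟨k, hk, hw⟩ := h
  obtain ⟨hpos, hcyc⟩ := returnLength_spec ⟨b₀ + k + a₀, by omega, (hb₀.trans hw).trans ha₀⟩
  set g := returnLength R y
  obtain ⟨a, ha, -, hxa⟩ := ha₀.exists_modEq_lt one_pos
  obtain ⟨b, hb, -, hbx⟩ := hb₀.exists_modEq_lt one_pos
  refine ⟨hpos, fun m hm hgm => ?_⟩
  have hle' : (a + b) * g ≤ m := by
    calc (a + b) * g ≤ (2 * Fintype.card S) * Fintype.card S :=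
          Nat.mul_le_mul (by omega) hle
      _ ≤ m := by nlinarith
  obtain ⟨q, hq⟩ : g ∣ m - (a + b) * g := Nat.dvd_sub hgm (Nat.dvd_mul_left _ _)
  have := ((hxa.trans ((hbx.trans hxa).mul (g - 1))).trans (hcyc.mul q)).trans hbx
  convert this using 1
  obtain ⟨g', hg'⟩ : ∃ g', g = g' + 1 := ⟨g - 1, by omega⟩
  rw [hg'] at hq hle' ⊢
  have : m = (g' + 1) * q + (a + b) * (g' + 1) := by omega
  rw [this, Nat.add_sub_cancel]
  ring

end

/-! ### A Landau-type bound for a common multiple -/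

/-- Positive integers with sum at most `n` have a common multiple of size `e^{O(√(n ln n))}`. With
`s = √(n ln n)`, those up to `s` divide `lcm(1, …, ⌊s⌋) = e^{ψ(s)} = e^{O(s)}`, by Chebyshev; at most
`n / s` of them exceed `s`, and their product is at most `n ^ (n / s) = e ^ s`. -/
theorem exists_common_multiple_log_le {ι : Type*} [Fintype ι] (f : ι → ℕ) {n : ℕ} (hn : 2 ≤ n)
    (hf : ∑ i, f i ≤ n) :
    ∃ P : ℕ, 0 < P ∧ (∀ i, 0 < f i → f i ∣ P) ∧
      Real.log P ≤ (Real.log 4 + 5) * √(n * Real.log n) := by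
  have hn1 : (1 : ℝ) < n := by exact_mod_cast (by omega : 1 < n)
  have hlog : 0 < Real.log n := Real.log_pos hn1
  set s := √(n * Real.log n) with hs
  have hs0 : 0 < s := Real.sqrt_pos.mpr (by positivity)
  have hss : s * s = n * Real.log n := Real.mul_self_sqrt (by positivity)
  set L := Finset.univ.filter fun i => ⌊s⌋₊ < f i with hL
  have hLpos : ∀ i ∈ L, 0 < f i := fun i hi => by
    have := (Finset.mem_filter.mp hi).2
    omega
  have hprod : 0 < ∏ i ∈ L, f i := Finset.prod_pos hLpos
  refine ⟨Nat.lcmUpto ⌊s⌋₊ * ∏ i ∈ L, f i,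
    Nat.mul_pos (Nat.lcmUpto_pos _) hprod, fun i hi => ?_, ?_⟩
  · by_cases h : ⌊s⌋₊ < f i
    · exact (Finset.dvd_prod_of_mem f (by simpa [hL] using h)).mul_left _
    · exact (Finset.dvd_lcm (f := id) (Finset.mem_Icc.mpr ⟨hi, not_lt.mp h⟩)).mul_right _
  · have hcard : L.card * s ≤ n := by
      calc (L.card : ℝ) * s = ∑ _i ∈ L, s := by simp
        _ ≤ ∑ i ∈ L, (f i : ℝ) := Finset.sum_le_sum fun i hi =>
            ((Nat.floor_lt hs0.le).mp (Finset.mem_filter.mp hi).2).le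
        _ ≤ ∑ i, (f i : ℝ) :=
            Finset.sum_le_sum_of_subset_of_nonneg (Finset.subset_univ _) (by simp)
        _ ≤ n := by exact_mod_cast hf
    have hbig : Real.log ((∏ i ∈ L, f i : ℕ) : ℝ) ≤ s := by
      rw [Nat.cast_prod, Real.log_prod fun i hi => by exact_mod_cast (hLpos i hi).ne']
      calc ∑ i ∈ L, Real.log (f i) ≤ ∑ _i ∈ L, Real.log n := by
            refine Finset.sum_le_sum fun i hi => Real.log_le_log
              (by exact_mod_cast hLpos i hi) ?_
            exact_mod_cast (Finset.single_le_sum (f := f) (by simp) (Finset.mem_univ i)).trans hf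
        _ = L.card * Real.log n := by simp
        _ ≤ s := by
            refine le_of_mul_le_mul_right ?_ hs0
            rw [hss]
            nlinarith
    have hsmall : Real.log (Nat.lcmUpto ⌊s⌋₊) ≤ (Real.log 4 + 4) * s := by
      rw [← Chebyshev.psi_eq_log_lcmUpto, ← Chebyshev.psi_eq_psi_coe_floor]
      exact Chebyshev.psi_le_const_mul_self hs0.le
    rw [Nat.cast_mul, Real.log_mul (by exact_mod_cast (Nat.lcmUpto_ne_zero _))
      (by exact_mod_cast hprod.ne')]
    linarith

/-! ### Pairs of distinct walks -/

/-- The relation whose walks encode two walks of `R` together: a state `inl a` records that both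
are at `a` and have agreed so far, a state `inr (a, b)` that they have already separated. -/
def splitRel {S : Type*} (R : S → S → Prop) : S ⊕ S × S → S ⊕ S × S → Prop
  | .inl a, .inl b => R a b
  | .inl a, .inr (b, c) => R a b ∧ R a c ∧ b ≠ c
  | .inr _, .inl _ => False
  | .inr (a, b), .inr (c, d) => R a c ∧ R b d

section

variable {S : Type*} {R : S → S → Prop}

theorem splitRel_fst (a b : S ⊕ S × S) (h : splitRel R a b) :
    R (a.elim id Prod.fst) (b.elim id Prod.fst) := by
  rcases a with a | ⟨a, a'⟩ <;> rcases b with b | ⟨b, b'⟩ <;> simp_all [splitRel]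

theorem splitRel_snd (a b : S ⊕ S × S) (h : splitRel R a b) :
    R (a.elim id Prod.snd) (b.elim id Prod.snd) := by
  rcases a with a | ⟨a, a'⟩ <;> rcases b with b | ⟨b, b'⟩ <;> simp_all [splitRel]

theorem hasWalk_splitRel_iff {k : ℕ} {u v w : S} :
    HasWalk (splitRel R) k (.inl u) (.inr (v, w)) ↔
      ∃ f g : ℕ → S, f 0 = u ∧ g 0 = u ∧ f k = v ∧ g k = w ∧ (∀ i < k, R (f i) (f (i + 1))) ∧
        (∀ i < k, R (g i) (g (i + 1))) ∧ ∃ i ≤ k, f i ≠ g i := by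
  classical
  constructor
  · rintro ⟨h, h0, hk, hh⟩
    refine ⟨fun i => (h i).elim id Prod.fst, fun i => (h i).elim id Prod.snd, by simp [h0],
      by simp [h0], by simp [hk], by simp [hk], fun i hi => splitRel_fst _ _ (hh i hi),
      fun i hi => splitRel_snd _ _ (hh i hi), ?_⟩
    -- The walks differ at the first time at which the state is of the form `inr`.
    have hex : ∃ i, (h i).isRight := ⟨k, by simp [hk]⟩
    have hle : Nat.find hex ≤ k := Nat.find_min' hex (by simp [hk])
    have hspec := Nat.find_spec hex
    refine ⟨Nat.find hex, hle, ?_⟩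
    obtain ⟨j, hj⟩ : ∃ j, Nat.find hex = j + 1 := by
      refine Nat.exists_eq_succ_of_ne_zero fun h' => ?_
      rw [h', h0] at hspec
      simp at hspec
    have hmin := Nat.find_min hex (m := j) (by omega)
    have hstep := hh j (by omega)
    rw [hj] at hspec ⊢
    rcases ha : h j with a | a <;> rcases hb : h (j + 1) with b | ⟨b, c⟩ <;>
      simp_all [splitRel]
  · rintro ⟨f, g, f0, g0, fk, gk, hf, hg, hex⟩
    have hle : Nat.find hex ≤ k := (Nat.find_spec hex).1
    have heq : ∀ i, i < Nat.find hex → f i = g i := fun i hi => by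
      have := Nat.find_min hex hi
      by_contra hne
      exact this ⟨by omega, hne⟩
    have hne := (Nat.find_spec hex).2
    have hpos : 0 < Nat.find hex := by
      refine Nat.pos_of_ne_zero fun h => ?_
      rw [h, f0, g0] at hne
      exact hne rfl
    generalize Nat.find hex = j at *
    refine ⟨fun i => if i < j then .inl (f i) else .inr (f i, g i), by simp [hpos, f0],
      by simp [not_lt.mpr hle, fk, gk], fun i hi => ?_⟩
    rcases lt_trichotomy (i + 1) j with h | h | h
    · simpa [h, show i < j by omega, splitRel] using hf i hi
    · subst h
      have := hg i hi
      rw [← heq i (by omega)] at this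
      simpa [splitRel] using ⟨hf i hi, this, hne⟩
    · simpa [show ¬ i < j by omega, show ¬ i + 1 < j by omega, splitRel] using ⟨hf i hi, hg i hi⟩

/-- The closed walks available in `R` at its recurrent states yield closed walks at the recurrent
states of `splitRel R`; at a pair of states they have the least common multiple as modulus. -/
theorem splitRel_pump {B G P : ℕ} {p : S → ℕ}
    (hpump : ∀ s, (∃ c, 0 < c ∧ HasWalk R c s s) →
      0 < p s ∧ p s ≤ G ∧ p s ∣ P ∧ ∀ m, B ≤ m → p s ∣ m → HasWalk R m s s)
    (s : S ⊕ S × S) (hs : ∃ c, 0 < c ∧ HasWalk (splitRel R) c s s) :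
    ∃ g, 0 < g ∧ g ≤ G ^ 2 ∧ g ∣ P ∧ ∀ m, B ≤ m → g ∣ m → HasWalk (splitRel R) m s s := by
  obtain ⟨c, hc, hw⟩ := hs
  have h₁ := hw.map (R' := R) _ splitRel_fst
  have h₂ := hw.map (R' := R) _ splitRel_snd
  rcases s with x | ⟨x, y⟩
  · obtain ⟨hp, hG, hP, hx⟩ := hpump x ⟨c, hc, h₁⟩
    exact ⟨p x, hp, by nlinarith, hP, fun m hm hd =>
      (hx m hm hd).map (R' := splitRel R) Sum.inl fun _ _ h => h⟩
  · obtain ⟨hp, hG, hP, hx⟩ := hpump x ⟨c, hc, h₁⟩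
    obtain ⟨hp', hG', hP', hy⟩ := hpump y ⟨c, hc, h₂⟩
    refine ⟨(p x).lcm (p y), Nat.lcm_pos hp hp', ?_, Nat.lcm_dvd hP hP', fun m hm hd => ?_⟩
    · calc (p x).lcm (p y) ≤ p x * p y := Nat.le_of_dvd (Nat.mul_pos hp hp') (Nat.lcm_dvd_mul _ _)
        _ ≤ G ^ 2 := by rw [sq]; exact Nat.mul_le_mul hG hG'
    · obtain ⟨f, f0, fm, hf⟩ := hx m hm ((Nat.dvd_lcm_left _ _).trans hd)
      obtain ⟨g, g0, gm, hg⟩ := hy m hm ((Nat.dvd_lcm_right _ _).trans hd)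
      exact ⟨fun i => .inr (f i, g i), by simp [f0, g0], by simp [fm, gm],
        fun i hi => ⟨hf i hi, hg i hi⟩⟩

end

/-! ### Unary automata -/

namespace NFAutomaton

variable {α σ : Type*} [Unique α]

/-- The transition relation of a unary automaton on its only letter. -/
def unaryRel (M : NFAutomaton α σ) (u v : σ) : Prop := v ∈ M.step u default

theorem isAcceptingPath_restrict_iff (M : NFAutomaton α σ) (w : List α) (f : ℕ → σ) :
    M.IsAcceptingPath w (fun i => f i) ↔
      f 0 = M.start ∧ (∀ i < w.length, M.unaryRel (f i) (f (i + 1))) ∧ f w.length ∈ M.accept := by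
  simp only [IsAcceptingPath, IsPath, unaryRel, Fin.forall_iff, Unique.eq_default, and_assoc]
  simp

theorem exists_eq_restrict {k : ℕ} (p : Fin (k + 1) → σ) :
    ∃ f : ℕ → σ, p = fun i : Fin (k + 1) => f i :=
  ⟨fun i => p (Fin.ofNat _ i), by ext i; simp⟩

theorem mem_nfaLanguage_iff_hasWalk (M : NFAutomaton α σ) (w : List α) :
    w ∈ M.nfaLanguage ↔ ∃ v ∈ M.accept, HasWalk M.unaryRel w.length M.start v := by
  constructor
  · rintro ⟨p, hp⟩
    obtain ⟨f, rfl⟩ := exists_eq_restrict p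
    obtain ⟨f0, hf, fk⟩ := (isAcceptingPath_restrict_iff M w f).mp hp
    exact ⟨_, fk, f, f0, rfl, hf⟩
  · rintro ⟨_, hv, f, f0, rfl, hf⟩
    exact ⟨_, (isAcceptingPath_restrict_iff M w f).mpr ⟨f0, hf, hv⟩⟩

theorem mem_xnfaLanguage_iff_hasWalk (M : NFAutomaton α σ) (w : List α) :
    w ∈ M.xnfaLanguage ↔ (∃ v ∈ M.accept, HasWalk M.unaryRel w.length M.start v) ∧
      ¬ ∃ v ∈ M.accept, ∃ v' ∈ M.accept,
        HasWalk (splitRel M.unaryRel) w.length (.inl M.start) (.inr (v, v')) := by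
  rw [← mem_nfaLanguage_iff_hasWalk]
  constructor
  · rintro ⟨p, hp, huniq⟩
    refine ⟨⟨p, hp⟩, ?_⟩
    rintro ⟨v, hv, v', hv', h⟩
    obtain ⟨f, g, f0, g0, rfl, rfl, hf, hg, i, hi, hne⟩ := hasWalk_splitRel_iff.mp h
    have h₁ := huniq _ ((isAcceptingPath_restrict_iff M w f).mpr ⟨f0, hf, hv⟩)
    have h₂ := huniq _ ((isAcceptingPath_restrict_iff M w g).mpr ⟨g0, hg, hv'⟩)
    exact hne (congrFun (h₁.trans h₂.symm) ⟨i, by omega⟩)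
  · rintro ⟨⟨p, hp⟩, hnot⟩
    refine ⟨p, hp, fun q hq => ?_⟩
    obtain ⟨f, rfl⟩ := exists_eq_restrict p
    obtain ⟨g, rfl⟩ := exists_eq_restrict q
    by_contra hne
    obtain ⟨i, hi⟩ := Function.ne_iff.mp hne
    obtain ⟨f0, hf, fk⟩ := (isAcceptingPath_restrict_iff M w f).mp hp
    obtain ⟨g0, hg, gk⟩ := (isAcceptingPath_restrict_iff M w g).mp hq
    exact hnot ⟨_, fk, _, gk, hasWalk_splitRel_iff.mpr
      ⟨f, g, f0, g0, rfl, rfl, hf, hg, i, i.is_le, Ne.symm hi⟩⟩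

/-- A unary language that is periodic with period `P` from length `t` on is accepted by a
deterministic automaton with `t + P` states: a tail of length `t` followed by a cycle of length
`P`. -/
theorem exists_nfaLanguage_eq_of_periodic {L : Language α} {A : ℕ → Prop} {t P : ℕ} (hP : 0 < P)
    (hL : ∀ w, w ∈ L ↔ A w.length)
    (hA : ∀ k l, t ≤ k → t ≤ l → k ≡ l [MOD P] → A k → A l) :
    ∃ N : NFAutomaton α (Fin (t + P)), N.nfaLanguage = L := by
  let r : ℕ → Fin (t + P) := fun k => ⟨if k < t then k else t + (k - t) % P, by
    have := Nat.mod_lt (k - t) hP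
    split_ifs <;> omega⟩
  have hmod : ∀ k, t ≤ k → t + (k - t) % P ≡ k [MOD P] := fun k hk => by
    simpa [Nat.add_sub_cancel' hk] using (Nat.mod_modEq (k - t) P).add_left t
  have hr : ∀ k, A (r k) ↔ A k := fun k => by
    by_cases hk : k < t
    · simp [r, hk]
    · simp only [r, hk, if_false]
      have := hmod k (by omega)
      exact ⟨hA _ _ (by omega) (by omega) this, hA _ _ (by omega) (by omega) this.symm⟩
  have hr1 : ∀ k, r (r k + 1) = r (k + 1) := fun k => by
    by_cases hk : k < t
    · simp [r, hk]
    · have h₁ : ¬ t + (k - t) % P + 1 < t := by omega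
      have h₂ : ¬ k + 1 < t := by omega
      ext
      simp only [r, hk, h₁, h₂, if_false]
      rw [show t + (k - t) % P + 1 - t = (k - t) % P + 1 by omega,
        show k + 1 - t = k - t + 1 by omega, Nat.mod_add_mod]
  refine ⟨⟨fun s _ => {r (s + 1)}, r 0, {s | A s}⟩, Set.ext fun w => ?_⟩
  refine (mem_nfaLanguage_iff_hasWalk _ w).trans ((Iff.trans ?_ (hr w.length)).trans (hL w).symm)
  constructor
  · rintro ⟨_, hv, f, f0, rfl, hf⟩
    have : ∀ i ≤ w.length, f i = r i := fun i => by
      induction i with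
      | zero => exact fun _ => f0
      | succ i ih =>
        intro hi
        have : f (i + 1) = r (f i + 1) := hf i (by omega)
        rw [this, ih (by omega), hr1]
    rw [← this _ le_rfl]
    exact hv
  · exact fun h => ⟨r w.length, h, r, rfl, rfl, fun i _ => (hr1 i).symm⟩

/-- The language of a unary `n`-state XNFA is periodic from length `n ^ 6` on, with a period that
is a common multiple of the cycle lengths attached to the strongly connected components. -/
theorem exists_nfaLanguage_eq_xnfaLanguage [Fintype σ] (M : NFAutomaton α σ) {n : ℕ} (hn : 2 ≤ n)
    (hσ : Fintype.card σ = n) :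
    ∃ P : ℕ, 0 < P ∧ Real.log P ≤ (Real.log 4 + 5) * √(n * Real.log n) ∧
      ∃ N : NFAutomaton α (Fin (n ^ 6 + P)), N.nfaLanguage = M.xnfaLanguage := by
  classical
  obtain ⟨P, hP, hdvd, hlog⟩ := exists_common_multiple_log_le
    (fun q : Quotient (sccSetoid M.unaryRel) => returnLength M.unaryRel q.out) hn
    (hσ ▸ sum_returnLength_le_card)
  have hpump : ∀ s, (∃ c, 0 < c ∧ HasWalk M.unaryRel c s s) →
      0 < sccPeriod M.unaryRel s ∧ sccPeriod M.unaryRel s ≤ n ∧ sccPeriod M.unaryRel s ∣ P ∧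
        ∀ m, 2 * n ^ 2 ≤ m → sccPeriod M.unaryRel s ∣ m → HasWalk M.unaryRel m s s := by
    intro s hs
    obtain ⟨h0, hw⟩ := hasWalk_of_sccPeriod_dvd hs
    exact ⟨h0, hσ ▸ sccPeriod_le_card s, hdvd _ h0, hσ ▸ hw⟩
  have hcard : Fintype.card (σ ⊕ σ × σ) = n + n * n := by simp [hσ]
  have h3 : 2 * n ^ 2 ≤ n ^ 3 := by
    rw [pow_succ' n 2]
    gcongr
  have h4 : 2 * n ^ 3 ≤ n ^ 4 := by
    rw [pow_succ' n 3]
    gcongr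
  have h6 : 4 * n ^ 4 ≤ n ^ 6 := by
    have : 4 * n ^ 4 ≤ (n * n) * n ^ 4 := by
      gcongr
      nlinarith
    linarith [this, show (n * n) * n ^ 4 = n ^ 6 by ring]
  have hn2 : n ≤ n ^ 2 := Nat.le_self_pow two_ne_zero n
  refine ⟨P, hP, hlog, exists_nfaLanguage_eq_of_periodic (A := fun k =>
    (∃ v ∈ M.accept, HasWalk M.unaryRel k M.start v) ∧ ¬ ∃ v ∈ M.accept, ∃ v' ∈ M.accept,
      HasWalk (splitRel M.unaryRel) k (.inl M.start) (.inr (v, v')))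
    hP (mem_xnfaLanguage_iff_hasWalk M) ?_⟩
  have hone : ∀ k l, n ^ 6 ≤ k → n ^ 6 ≤ l → k ≡ l [MOD P] → ∀ v,
      HasWalk M.unaryRel k M.start v → HasWalk M.unaryRel l M.start v := by
    refine fun k l hk hl hkl v => HasWalk.of_modEq (B := 2 * n ^ 2) (G := n)
      (fun s hs => ⟨_, hpump s hs⟩) (by omega) ?_ hkl
    rw [hσ]
    nlinarith
  have htwo : ∀ k l, n ^ 6 ≤ k → n ^ 6 ≤ l → k ≡ l [MOD P] → ∀ v,
      HasWalk (splitRel M.unaryRel) k (.inl M.start) v →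
        HasWalk (splitRel M.unaryRel) l (.inl M.start) v := by
    refine fun k l hk hl hkl v => HasWalk.of_modEq (B := 2 * n ^ 2) (G := n ^ 2)
      (splitRel_pump hpump) ?_ ?_ hkl
    · rw [hcard]
      nlinarith
    · rw [hcard]
      have : (n + n * n) * n ^ 2 = n ^ 3 + n ^ 4 := by ring
      omega
  rintro k l hk hl hkl ⟨⟨v, hv, h⟩, hnot⟩
  exact ⟨⟨v, hv, hone k l hk hl hkl v h⟩, fun ⟨v, hv, v', hv', h⟩ =>
    hnot ⟨v, hv, v', hv', htwo l k hl hk hkl.symm _ h⟩⟩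

end NFAutomaton

/-! ### The state bound -/

/-- For unary `n`-state XNFAs, `n ≥ 2`, `e^{Θ(√(n ln n))}` states are sufficient for an NFA to
accept the same language. Unary means that the alphabet has exactly one symbol. -/
theorem mainTheorem8 :
    ∃ h : ℕ → ℝ,
      Asymptotics.IsTheta Filter.atTop h (fun n : ℕ => Real.sqrt ((n : ℝ) * Real.log (n : ℝ))) ∧
      ∀ n : ℕ, 2 ≤ n →
        ∀ (α : Type*) [Unique α] (σ : Type*) [Fintype σ], Fintype.card σ = n →
          ∀ M : NFAutomaton α σ,
            ∃ m : ℕ, (m : ℝ) ≤ Real.exp (h n) ∧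
              ∃ N : NFAutomaton α (Fin m), N.nfaLanguage = M.xnfaLanguage := by
  have hlog4 : 0 < Real.log 4 := Real.log_pos (by norm_num)
  -- The common multiple contributes `log 4 + 5`, and the factor `n ^ 7` below contributes `7`, since
  -- `log n ≤ √(n log n)`.
  refine ⟨fun n => (Real.log 4 + 12) * √(n * Real.log n),
    (Asymptotics.isTheta_refl _ _).const_mul_left (by positivity), ?_⟩
  intro n hn α _ σ _ hσ M
  obtain ⟨P, hP, hlog, N, hN⟩ := M.exists_nfaLanguage_eq_xnfaLanguage hn hσ
  refine ⟨n ^ 6 + P, ?_, N, hN⟩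
  have hn' : (2 : ℝ) ≤ n := by exact_mod_cast hn
  have hn0 : (0 : ℝ) < n := by linarith
  have hP' : (1 : ℝ) ≤ P := by exact_mod_cast hP
  have hlogn : Real.log n ≤ √(n * Real.log n) := by
    have h0 : 0 ≤ Real.log n := Real.log_nonneg (by linarith)
    refine Real.le_sqrt_of_sq_le ?_
    rw [sq]
    gcongr
    exact Real.log_le_self hn0.le
  have hle : ((n ^ 6 + P : ℕ) : ℝ) ≤ (n : ℝ) ^ 7 * P := by
    have h1 : (1 : ℝ) ≤ (n : ℝ) ^ 6 := one_le_pow₀ (by linarith)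
    push_cast
    calc (n : ℝ) ^ 6 + P ≤ 2 * ((n : ℝ) ^ 6 * P) := by nlinarith
      _ ≤ n * ((n : ℝ) ^ 6 * P) := by gcongr
      _ = (n : ℝ) ^ 7 * P := by ring
  refine hle.trans ((Real.log_le_iff_le_exp (by positivity)).mp ?_)
  rw [Real.log_mul (by positivity) (by positivity), Real.log_pow]
  push_cast
  linarith
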